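/- Let $g_1,\dots,g_m\in\mathbb{R}[x_1,\dots,x_n]$ be such that $\Omega=\{x\in\mathbb{R}^n : g_j(x)\ge 0,\ j=1,\dots,m\}$ is compact with nonempty interior, and put $d_j=\lceil \deg g_j/2\rceil$. Let $\lambda$ be a finite Borel measure on $\mathbb{R}^n$ with $\lambda(\mathbb{R}^n\setminus\Omega)=0$ whose support contains some nonempty open set $O\subseteq\Omega$ (for example $\operatorname{supp}\lambda=\Omega$), and let $u\in L^2(\Omega,\lambda)$ with $u\ge 0$ $\lambda$-almost everywhere. For $d\in\mathbb{N}$ let $\mathbf{b}_d(x)=(x^\alpha)_{|\alpha|\le d}$ be the vector of all monomials of degree at most $d$, and let $s(d)=\binom{n+d}{d}$ be its length. For $d\ge\max_j d_j$ consider the semidefinite program $$\min_{p}\ \int_\Omega (u-p)^2\,d\lambda$$ over all polynomials $p\in\mathbb{R}[x_1,\dots,x_n]$ of degree at most $d$ for which there are real symmetric positive semidefinite matrices $A_0$ of size $s(d)$ and $A_j$ of size $s(d-d_j)$, $j=1,\dots,m$, with $$p(x)=\mathbf{b}_d(x)^T A_0\,\mathbf{b}_d(x)+\sum_{j=1}^m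 \mathbf{b}_{d-d_j}(x)^T A_j\,\mathbf{b}_{d-d_j}(x)\,g_j(x).$$ Then for every $d\ge\max_j d_j$ this problem has an optimal solution; every optimal solution is nonnegative on $\Omega$; and for every choice of optimal solutions $u_d^*$, $d\ge\max_j d_j$, one has $\int_\Omega (u-u_d^*)^2\,d\lambda\to 0$ as $d\to\infty$. -/

import Mathlib

open MvPolynomial MeasureTheory Filter Topology Matrix

noncomputable section

/-- The basic semialgebraic set `{x ∈ ℝⁿ | g₁(x) ≥ 0, …, g_m(x) ≥ 0}`. -/
def basicSemialgebraicSet {n m : ℕ} (g : Fin m → MvPolynomial (Fin n) ℝ) : Set (Fin n → ℝ) :=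
  {x | ∀ j, 0 ≤ eval x (g j)}

/-- The multi-indices `α ∈ ℕⁿ` with `α₁ + ⋯ + αₙ ≤ d`. -/
abbrev MultiIndex (n d : ℕ) : Type := {α : Fin n →₀ ℕ // α.degree ≤ d}

instance instFintypeMultiIndex (n d : ℕ) : Fintype (MultiIndex n d) :=
  (Finsupp.finite_of_degree_le (σ := Fin n) d).fintype

/-- The vector `b_d(x) = (x^α)`, `|α| ≤ d`, of all monomials of degree at most `d`. -/
def monomialVector (n d : ℕ) : MultiIndex n d → MvPolynomial (Fin n) ℝ :=
  fun α => monomial α.1 1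

/-- The polynomial `b_d(x)ᵀ A b_d(x)`. -/
def gramPolynomial {n d : ℕ} (A : Matrix (MultiIndex n d) (MultiIndex n d) ℝ) :
    MvPolynomial (Fin n) ℝ :=
  monomialVector n d ⬝ᵥ (A.map C *ᵥ monomialVector n d)

/-- `⌈deg p / 2⌉`. -/
def halfDegree {n : ℕ} (p : MvPolynomial (Fin n) ℝ) : ℕ := (p.totalDegree + 1) / 2

/-- `p` is feasible at level `d`: it has degree at most `d` and
`p = b_dᵀ A₀ b_d + ∑ⱼ (b_{d-dⱼ}ᵀ Aⱼ b_{d-dⱼ}) gⱼ` for symmetric positive semidefinite real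
matrices `A₀, …, A_m`, where `dⱼ = ⌈deg gⱼ / 2⌉`. It is used for `d ≥ maxⱼ dⱼ` only. -/
def IsPutinarFeasible {n m : ℕ} (g : Fin m → MvPolynomial (Fin n) ℝ) (d : ℕ)
    (p : MvPolynomial (Fin n) ℝ) : Prop :=
  p.totalDegree ≤ d ∧
    ∃ (A₀ : Matrix (MultiIndex n d) (MultiIndex n d) ℝ)
      (A : ∀ j : Fin m, Matrix (MultiIndex n (d - halfDegree (g j)))
        (MultiIndex n (d - halfDegree (g j))) ℝ),
      A₀.PosSemidef ∧ (∀ j, (A j).PosSemidef) ∧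
        p = gramPolynomial A₀ + ∑ j, gramPolynomial (A j) * g j

/-- The objective `‖u - p‖₂² = ∫_Ω (u - p)² dlam`. -/
def sqL2Dist {n : ℕ} (Ω : Set (Fin n → ℝ)) (lam : Measure (Fin n → ℝ)) (u : (Fin n → ℝ) → ℝ)
    (p : MvPolynomial (Fin n) ℝ) : ℝ :=
  ∫ x in Ω, (u x - eval x p) ^ 2 ∂lam

/-- `p` is an optimal solution of: minimize `‖u - p‖₂²` over all `p` feasible at level `d`. -/
def IsPutinarOptimal {n m : ℕ} (g : Fin m → MvPolynomial (Fin n) ℝ) (lam : Measure (Fin n → ℝ))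
    (u : (Fin n → ℝ) → ℝ) (d : ℕ) (p : MvPolynomial (Fin n) ℝ) : Prop :=
  IsPutinarFeasible g d p ∧
    ∀ q, IsPutinarFeasible g d q →
      sqL2Dist (basicSemialgebraicSet g) lam u p ≤ sqL2Dist (basicSemialgebraicSet g) lam u q

end

/-! ### Attained distance to closed cones; vanishing criteria -/

noncomputable section

/-! Existence: parametrize feasible polynomials by the closed cone of Gram tuples, normalized so
that blocks with `g j = 0` vanish. Pairing with the constant 1 in `L²` is integration, and it is
strictly positive on nonzero tuples: a zero integral makes the nonnegative polynomial vanish on `O`,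
hence each summand vanishes there, hence each summand is the zero polynomial, hence each Gram matrix
is zero. So sublevel sets of the distance are bounded and a minimizer exists
(`exists_forall_norm_sub_le_of_closed_cone`, `eq_zero_of_putinarLinearMap_eq_zero`).

Convergence: squares of polynomials alone approximate `u` in `L²` (`exists_sqL2Dist_sq_lt`, via
Stone–Weierstrass applied to a square root), and each square is feasible for all large `d`. No
Positivstellensatz or Archimedean condition enters. -/

/-- A linear map into a Hilbert space that is strictly positive, in the direction `e`, on the nonzero
elements of a closed cone attains its distance to any point on that cone. -/
theorem exists_forall_norm_sub_le_of_closed_cone {E H : Type*} [NormedAddCommGroup E]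
    [NormedSpace ℝ E] [FiniteDimensional ℝ E] [NormedAddCommGroup H] [InnerProductSpace ℝ H]
    {K : Set E} (hK : IsClosed K) (h0 : (0 : E) ∈ K)
    (hcone : ∀ c : ℝ, 0 ≤ c → ∀ x ∈ K, c • x ∈ K) (T : E →ₗ[ℝ] H) (e : H)
    (hpos : ∀ x ∈ K, x ≠ 0 → 0 < inner ℝ e (T x)) (U : H) :
    ∃ x ∈ K, ∀ y ∈ K, ‖U - T x‖ ≤ ‖U - T y‖ := by
  have : ProperSpace E := FiniteDimensional.proper_real E
  have hT : Continuous T := T.continuous_of_finiteDimensional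
  have hS : IsCompact (K ∩ Metric.sphere 0 1) := (isCompact_sphere 0 1).inter_left hK
  -- The positive functional has a positive minimum on the compact base of the cone; homogeneity
  -- spreads the bound.
  obtain ⟨c, hc, hcK⟩ : ∃ c > 0, ∀ x ∈ K, c * ‖x‖ ≤ inner ℝ e (T x) := by
    rcases (K ∩ Metric.sphere 0 1).eq_empty_or_nonempty with hE | hne
    · refine ⟨1, one_pos, fun x hx => ?_⟩
      by_cases hx0 : x = 0
      · simp [hx0]
      · have : ‖x‖⁻¹ • x ∈ K ∩ Metric.sphere 0 1 :=
          ⟨hcone _ (by positivity) x hx, by simp [norm_smul, hx0]⟩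
        simp [hE] at this
    · obtain ⟨z, hz, hmin⟩ := hS.exists_isMinOn hne
        (f := fun x => inner ℝ e (T x)) (by fun_prop)
      have hz0 : z ≠ 0 := by
        rintro rfl
        simpa using hz.2
      refine ⟨_, hpos z hz.1 hz0, fun x hx => ?_⟩
      by_cases hx0 : x = 0
      · simp [hx0]
      · have hxn : 0 < ‖x‖ := norm_pos_iff.2 hx0
        have : ‖x‖⁻¹ • x ∈ K ∩ Metric.sphere 0 1 :=
          ⟨hcone _ (by positivity) x hx, by simp [norm_smul, hx0]⟩
        have h1 : inner ℝ e (T z) ≤ inner ℝ e (T (‖x‖⁻¹ • x)) := hmin this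
        rw [map_smul, inner_smul_right, inv_mul_eq_div, le_div_iff₀ hxn] at h1
        exact h1
  -- From `c * ‖x‖ ≤ ⟪e, T x⟫ ≤ ‖e‖ * ‖T x‖` and `‖T x‖ ≤ 2 * ‖U‖` for points doing no worse than 0.
  set R : ℝ := ‖e‖ * (‖U‖ + ‖U‖) / c with hR
  have hR0 : 0 ≤ R := by positivity
  have hbound : ∀ x ∈ K, ‖U - T x‖ ≤ ‖U‖ → ‖x‖ ≤ R := by
    intro x hx hxU
    have h1 : inner ℝ e (T x) ≤ ‖e‖ * ‖T x‖ := real_inner_le_norm _ _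
    have h2 : ‖T x‖ ≤ ‖U‖ + ‖U‖ := by
      calc ‖T x‖ = ‖U - (U - T x)‖ := by simp
        _ ≤ ‖U‖ + ‖U - T x‖ := norm_sub_le _ _
        _ ≤ _ := by gcongr
    rw [hR, le_div_iff₀ hc, mul_comm]
    exact (hcK x hx).trans (h1.trans (by gcongr))
  obtain ⟨x, hx, hmin⟩ := ((isCompact_closedBall (0 : E) R).inter_left hK).exists_isMinOn
    (f := fun x => ‖U - T x‖) ⟨0, h0, by simpa using hR0⟩ (by fun_prop)
  refine ⟨x, hx.1, fun y hy => ?_⟩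
  by_cases hyU : ‖U - T y‖ ≤ ‖U‖
  · exact hmin ⟨hy, by simpa using hbound y hy hyU⟩
  · have h1 : ‖U - T x‖ ≤ ‖U - T 0‖ := hmin ⟨h0, by simpa using hR0⟩
    rw [map_zero, sub_zero] at h1
    linarith

theorem isClosed_setOf_posSemidef (ι : Type*) [Fintype ι] :
    IsClosed {A : Matrix ι ι ℝ | A.PosSemidef} := by
  have : {A : Matrix ι ι ℝ | A.PosSemidef} =
      {A | Aᴴ = A} ∩ ⋂ x : ι → ℝ, {A | 0 ≤ star x ⬝ᵥ (A *ᵥ x)} := by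
    ext A
    simp only [Set.mem_ofPred_eq, Set.mem_inter_iff, Set.mem_iInter]
    exact ⟨fun h => ⟨h.1, h.dotProduct_mulVec_nonneg⟩,
      fun h => .of_dotProduct_mulVec_nonneg h.1 h.2⟩
  rw [this]
  refine (isClosed_eq (by fun_prop) (by fun_prop)).inter (isClosed_iInter fun x => ?_)
  exact isClosed_le (by fun_prop) (by fun_prop)

/-- A sup-norm ball is a product of intervals, that is, of infinite sets. -/
theorem MvPolynomial.eq_zero_of_eval_eq_zero_on_isOpen {n : ℕ} {O : Set (Fin n → ℝ)}
    (hO : IsOpen O) (hne : O.Nonempty) {p : MvPolynomial (Fin n) ℝ}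
    (h : ∀ x ∈ O, eval x p = 0) : p = 0 := by
  obtain ⟨x, hx⟩ := hne
  obtain ⟨ε, hε, hball⟩ := Metric.isOpen_iff.1 hO x hx
  refine funext_set (fun i => Metric.ball (x i) ε) (fun i => ?_) fun y hy => ?_
  · rw [Real.ball_eq_Ioo]
    exact Set.Ioo_infinite (by linarith)
  · rw [map_zero]
    refine h y (hball ?_)
    rw [← ball_pi x hε] at *
    exact hy

/-- A continuous function that vanishes almost everywhere vanishes on the support. -/
theorem Continuous.eq_zero_of_mem_measure_support {X : Type*} [TopologicalSpace X]
    [MeasurableSpace X] {μ : Measure X} {f : X → ℝ} (hf : Continuous f) (h : f =ᵐ[μ] 0) {x : X}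
    (hx : x ∈ μ.support) : f x = 0 := by
  by_contra hne
  have hpos := (Measure.mem_support_iff_forall x).1 hx _
    ((isOpen_ne.preimage hf : IsOpen {y | f y ≠ 0}).mem_nhds hne)
  exact hpos.ne' h

/-! ### Gram matrices and squares -/

section Gram

variable {n d : ℕ}

theorem eval_gramPolynomial (A : Matrix (MultiIndex n d) (MultiIndex n d) ℝ) (x : Fin n → ℝ) :
    eval x (gramPolynomial A) =
      (fun α => eval x (monomialVector n d α)) ⬝ᵥ
        (A *ᵥ fun α => eval x (monomialVector n d α)) := by
  simp [gramPolynomial, dotProduct, mulVec, map_sum]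

theorem eval_gramPolynomial_nonneg {A : Matrix (MultiIndex n d) (MultiIndex n d) ℝ}
    (hA : A.PosSemidef) (x : Fin n → ℝ) : 0 ≤ eval x (gramPolynomial A) := by
  rw [eval_gramPolynomial]
  exact hA.dotProduct_mulVec_nonneg _

/-- `A ↦ b_dᵀ A b_d` as a linear map. -/
def gramLinearMap (n d : ℕ) :
    Matrix (MultiIndex n d) (MultiIndex n d) ℝ →ₗ[ℝ] MvPolynomial (Fin n) ℝ where
  toFun := gramPolynomial
  map_add' A B := by
    refine MvPolynomial.funext fun x => ?_
    simp only [map_add, eval_gramPolynomial, add_mulVec, dotProduct_add]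
  map_smul' c A := by
    refine MvPolynomial.funext fun x => ?_
    simp only [RingHom.id_apply, smul_eval, eval_gramPolynomial, smul_mulVec, dotProduct_smul,
      smul_eq_mul]

/-- For positive semidefinite `A`, `bᵀ A b = 0` forces `A b = 0`; the entries of `A` are the
coefficients of the polynomials in `A b`. -/
theorem eq_zero_of_gramPolynomial_eq_zero {A : Matrix (MultiIndex n d) (MultiIndex n d) ℝ}
    (hA : A.PosSemidef) (h : gramPolynomial A = 0) : A = 0 := by
  have hrow : ∀ α, ∑ β, C (A α β) * monomialVector n d β = 0 := by
    intro α
    refine MvPolynomial.funext fun x => ?_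
    have h1 := (hA.dotProduct_mulVec_zero_iff fun α => eval x (monomialVector n d α)).1 (by
      have := eval_gramPolynomial A x
      rw [h, map_zero] at this
      exact this.symm)
    simpa [mulVec, dotProduct] using congrFun h1 α
  ext α β
  classical
  have h2 := congrArg (coeff β.1) (hrow α)
  simpa [coeff_sum, monomialVector, coeff_C_mul, coeff_monomial, Subtype.val_inj] using h2

theorem exists_posSemidef_gramPolynomial_eq_sq {q : MvPolynomial (Fin n) ℝ}
    (hq : q.totalDegree ≤ d) :
    ∃ A : Matrix (MultiIndex n d) (MultiIndex n d) ℝ, A.PosSemidef ∧ gramPolynomial A = q ^ 2 := by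
  have hsum : ∑ α : MultiIndex n d, C (coeff α.1 q) * monomialVector n d α = q := by
    classical
    ext β
    simp only [coeff_sum, monomialVector, coeff_C_mul, coeff_monomial, mul_ite, mul_one, mul_zero]
    by_cases hβ : β.degree ≤ d
    · rw [Finset.sum_eq_single ⟨β, hβ⟩] <;> aesop
    · rw [Finset.sum_eq_zero fun α _ => if_neg fun h : α.1 = β => hβ (h ▸ α.2)]
      by_contra hne
      refine hβ (le_trans ?_ hq)
      rw [Finsupp.degree_eq_sum]
      have := le_totalDegree (mem_support_iff.2 (Ne.symm hne))
      rwa [Finsupp.sum_fintype _ _ (by simp)] at this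
  -- The rank-one matrix of the coefficient vector of `q`.
  refine ⟨vecMulVec (fun α => coeff α.1 q) (fun α => coeff α.1 q), ?_, ?_⟩
  · exact posSemidef_vecMulVec_self_star (R := ℝ) fun α : MultiIndex n d => coeff α.1 q
  · refine MvPolynomial.funext fun x => ?_
    conv_rhs => rw [← hsum]
    simp only [eval_gramPolynomial, vecMulVec_mulVec, dotProduct_smul, map_sum, map_mul, eval_C,
      sq]
    simp [dotProduct, mul_comm]

end Gram

/-! ### Density of squares in the nonnegative part of `L²` -/

section SquareApproximation

variable {n : ℕ} {Ω : Set (Fin n → ℝ)}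

/-- On a compact set the squares of polynomials are uniformly dense in the nonnegative continuous
functions. -/
theorem exists_sq_eval_near (hΩ : IsCompact Ω) {f : (Fin n → ℝ) → ℝ} (hf : Continuous f)
    (hf0 : ∀ x, 0 ≤ f x) {ε : ℝ} (hε : 0 < ε) :
    ∃ q : MvPolynomial (Fin n) ℝ, ∀ x ∈ Ω, |f x - eval x q ^ 2| < ε := by
  have : CompactSpace Ω := isCompact_iff_compactSpace.1 hΩ
  -- Approximate the square root uniformly; squaring is continuous in the sup norm.
  let s : C(Ω, ℝ) := ⟨fun x => √(f x), by fun_prop⟩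
  let ev : MvPolynomial (Fin n) ℝ →ₐ[ℝ] C(Ω, ℝ) :=
    aeval fun i => ⟨fun x => x.1 i, (continuous_apply i).comp continuous_subtype_val⟩
  have hev : ∀ q (x : Ω), ev q x = eval x.1 q := by
    intro q x
    induction q using MvPolynomial.induction_on with
    | C a => simp [ev]
    | add p q hp hq => simp [hp, hq]
    | mul_X p i hp => simp [hp, ev]
  have hsep : ev.range.SeparatesPoints := by
    intro x y hxy
    obtain ⟨i, hi⟩ := Function.ne_iff.1 (Subtype.coe_injective.ne hxy)
    refine ⟨_, ⟨ev (X i), ⟨X i, rfl⟩, rfl⟩, ?_⟩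
    simpa [hev] using hi
  have hcl : s ∈ closure (ev.range : Set C(Ω, ℝ)) :=
    ContinuousMap.continuousMap_mem_subalgebra_closure_of_separatesPoints _ hsep s
  have hnhds : {h : C(Ω, ℝ) | h ^ 2 ∈ Metric.ball (s ^ 2) ε} ∈ 𝓝 s :=
    (continuous_pow 2).continuousAt.preimage_mem_nhds (Metric.ball_mem_nhds _ hε)
  obtain ⟨_, hh, q, rfl⟩ := mem_closure_iff_nhds.1 hcl _ hnhds
  refine ⟨q, fun x hx => ?_⟩
  have h1 := (ContinuousMap.dist_apply_le_dist (f := ev q ^ 2) (g := s ^ 2) ⟨x, hx⟩).trans_lt hh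
  rw [dist_comm, Real.dist_eq] at h1
  have h2 : (ev q ^ 2) ⟨x, hx⟩ = eval x q ^ 2 := by simp [hev]
  have h3 : (s ^ 2) ⟨x, hx⟩ = f x := by simp [s, Real.sq_sqrt (hf0 x)]
  rwa [← h2, ← h3]

variable {lam : Measure (Fin n → ℝ)}

theorem memLp_eval [IsFiniteMeasure lam] (hΩ : IsCompact Ω) (hlam : lam Ωᶜ = 0) (p : MvPolynomial (Fin n) ℝ) :
    MemLp (fun x => eval x p) 2 lam := by
  obtain ⟨M, hM⟩ := hΩ.exists_bound_of_continuousOn (f := fun x => eval x p)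
    p.continuous_eval.continuousOn
  refine .of_bound p.continuous_eval.aestronglyMeasurable M ?_
  filter_upwards [mem_ae_iff.2 hlam] with x hx using hM x hx

theorem sqL2Dist_eq (hlam : lam Ωᶜ = 0) {u : (Fin n → ℝ) → ℝ} (hu : MemLp u 2 lam)
    {p : MvPolynomial (Fin n) ℝ} (hp : MemLp (fun x => eval x p) 2 lam) :
    sqL2Dist Ω lam u p = ‖hu.toLp u - hp.toLp‖ ^ 2 := by
  rw [sqL2Dist, Measure.restrict_eq_self_of_ae_mem (mem_ae_iff.2 hlam), ← MemLp.toLp_sub,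
    ← real_inner_self_eq_norm_sq, L2.inner_def]
  refine integral_congr_ae ?_
  filter_upwards [(hu.sub hp).coeFn_toLp] with x hx
  rw [hx]
  simp [sq]

theorem exists_sqL2Dist_sq_lt [IsFiniteMeasure lam] (hΩ : IsCompact Ω) (hlam : lam Ωᶜ = 0) {u : (Fin n → ℝ) → ℝ}
    (hu0 : ∀ᵐ x ∂lam, 0 ≤ u x) (hu : MemLp u 2 lam) {ε : ℝ} (hε : 0 < ε) :
    ∃ q : MvPolynomial (Fin n) ℝ, sqL2Dist Ω lam u (q ^ 2) < ε := by
  set δ : ℝ := √ε / 2 with hδ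
  have hδ0 : 0 < δ := by positivity
  obtain ⟨f, hf, hfL⟩ := hu.exists_boundedContinuous_eLpNorm_sub_le (by simp)
    (ε := ENNReal.ofReal δ) (by simpa using hδ0)
  -- `M` converts a uniform bound into an `L²` bound; dividing by `M + 1` covers `M = 0` and keeps
  -- the second error below `δ`.
  set M : ℝ := (lam.real Set.univ) ^ (2 : ENNReal).toReal⁻¹ with hM
  have hM0 : 0 ≤ M := by positivity
  obtain ⟨q, hq⟩ := exists_sq_eval_near hΩ (f := fun x => max (f x) 0) (by fun_prop)
    (fun x => le_max_right _ _) (ε := δ / (M + 1)) (by positivity)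
  refine ⟨q, ?_⟩
  have hqL := memLp_eval hΩ hlam (q ^ 2)
  have hfpL : MemLp (fun x => max (f x) 0) 2 lam := hfL.pos_part
  -- Since `u ≥ 0`, replacing `f` by its positive part brings it no farther from `u`.
  have h1 : ‖hu.toLp u - hfpL.toLp‖ ≤ δ := by
    rw [← MemLp.toLp_sub, Lp.norm_toLp]
    refine ENNReal.toReal_le_of_le_ofReal (by positivity) (le_trans ?_ hf)
    refine eLpNorm_mono_ae ?_
    filter_upwards [hu0] with x hx
    have := abs_max_sub_max_le_abs (u x) (f x) 0
    rw [max_eq_left hx] at this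
    exact this
  have h2 : ‖hfpL.toLp - hqL.toLp‖ ≤ M * (δ / (M + 1)) := by
    rw [← MemLp.toLp_sub]
    refine Lp.norm_le_of_ae_bound (by positivity) ?_
    filter_upwards [(hfpL.sub hqL).coeFn_toLp, mem_ae_iff.2 hlam] with x hx hxΩ
    rw [hx]
    simpa using (hq x hxΩ).le
  have h3 : M * (δ / (M + 1)) < δ := by
    rw [mul_div_assoc', div_lt_iff₀ (by positivity)]
    nlinarith
  have h4 : ‖hu.toLp u - hqL.toLp‖ < √ε := by
    have := norm_sub_le_norm_sub_add_norm_sub (hu.toLp u) hfpL.toLp hqL.toLp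
    linarith
  rw [sqL2Dist_eq hlam hu hqL]
  calc _ < √ε ^ 2 := by gcongr
    _ = ε := Real.sq_sqrt hε.le

end SquareApproximation

/-! ### The cone of Gram tuples and existence of minimizers -/

section Feasible

attribute [local instance] Matrix.normedAddCommGroup Matrix.normedSpace

variable {n m : ℕ} (g : Fin m → MvPolynomial (Fin n) ℝ) (d : ℕ)

/-- The tuples `(A₀, A₁, …, A_m)` of Gram matrices at level `d`. -/
abbrev GramTuple : Type :=
  Matrix (MultiIndex n d) (MultiIndex n d) ℝ ×
    ∀ j : Fin m, Matrix (MultiIndex n (d - halfDegree (g j)))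
      (MultiIndex n (d - halfDegree (g j))) ℝ

/-- The polynomial `b_dᵀ A₀ b_d + ∑ⱼ (b_{d-dⱼ}ᵀ Aⱼ b_{d-dⱼ}) gⱼ` as a linear function of the
tuple of Gram matrices. -/
def putinarLinearMap : GramTuple g d →ₗ[ℝ] MvPolynomial (Fin n) ℝ :=
  gramLinearMap n d ∘ₗ LinearMap.fst ℝ _ _ +
    ∑ j, LinearMap.mulRight ℝ (g j) ∘ₗ gramLinearMap n (d - halfDegree (g j)) ∘ₗ
      LinearMap.proj j ∘ₗ LinearMap.snd ℝ _ _

theorem putinarLinearMap_apply (A : GramTuple g d) :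
    putinarLinearMap g d A = gramPolynomial A.1 + ∑ j, gramPolynomial (A.2 j) * g j := by
  simp [putinarLinearMap, gramLinearMap]

/-- The positive semidefinite tuples whose polynomial has degree at most `d`, normalized by
`Aⱼ = 0` whenever `gⱼ = 0`. -/
def putinarCone : Set (GramTuple g d) :=
  {A | A.1.PosSemidef ∧ (∀ j, (A.2 j).PosSemidef) ∧ (∀ j, g j = 0 → A.2 j = 0) ∧
    putinarLinearMap g d A ∈ restrictTotalDegree (Fin n) ℝ d}

variable {g d}

theorem isPutinarFeasible_iff {p : MvPolynomial (Fin n) ℝ} :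
    IsPutinarFeasible g d p ↔ ∃ A ∈ putinarCone g d, putinarLinearMap g d A = p := by
  classical
  constructor
  · rintro ⟨hdeg, A₀, A, hA₀, hA, hp⟩
    -- A block with `g j = 0` does not affect `p`, so it can be zeroed; left free, it would destroy
    -- strict positivity on the cone.
    obtain ⟨B, hB0, hB⟩ : ∃ B : GramTuple g d,
        (∀ j, g j = 0 → B.2 j = 0) ∧ B.1 = A₀ ∧ ∀ j, g j ≠ 0 → B.2 j = A j :=
      ⟨(A₀, fun j => if g j = 0 then 0 else A j), fun j hj => if_pos hj, rfl,
        fun j hj => if_neg hj⟩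
    have hBp : putinarLinearMap g d B = p := by
      rw [putinarLinearMap_apply, hp, hB.1]
      refine congrArg _ (Finset.sum_congr rfl fun j _ => ?_)
      by_cases hj : g j = 0
      · exact (mul_eq_zero_of_right _ hj).trans (mul_eq_zero_of_right _ hj).symm
      · rw [hB.2 j hj]
    refine ⟨B, ⟨hB.1 ▸ hA₀, fun j => ?_, hB0, ?_⟩, hBp⟩
    · by_cases hj : g j = 0
      · exact hB0 j hj ▸ .zero
      · exact hB.2 j hj ▸ hA j
    · rwa [hBp, mem_restrictTotalDegree]
  · rintro ⟨A, ⟨h0, hA, -, hdeg⟩, rfl⟩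
    exact ⟨(mem_restrictTotalDegree _ _ _).1 hdeg, A.1, A.2, h0, hA, putinarLinearMap_apply g d A⟩

theorem isClosed_putinarCone : IsClosed (putinarCone g d) := by
  have h1 : IsClosed {A : GramTuple g d | A.1.PosSemidef} :=
    (isClosed_setOf_posSemidef _).preimage continuous_fst
  have h2 : IsClosed {A : GramTuple g d | ∀ j, (A.2 j).PosSemidef} := by
    rw [Set.ofPred_forall]
    exact isClosed_iInter fun j =>
      (isClosed_setOf_posSemidef (MultiIndex n (d - halfDegree (g j)))).preimage
        (f := fun A : GramTuple g d => A.2 j) ((continuous_apply j).comp continuous_snd)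
  have h3 : IsClosed {A : GramTuple g d | ∀ j, g j = 0 → A.2 j = 0} := by
    simp only [Set.ofPred_forall]
    exact isClosed_iInter fun j => isClosed_iInter fun _ =>
      isClosed_eq ((continuous_apply j).comp continuous_snd) continuous_const
  have h4 : IsClosed
      {A : GramTuple g d | putinarLinearMap g d A ∈ restrictTotalDegree (Fin n) ℝ d} :=
    ((restrictTotalDegree (Fin n) ℝ d).comap (putinarLinearMap g d)).closed_of_finiteDimensional
  exact h1.inter (h2.inter (h3.inter h4))

theorem smul_mem_putinarCone {c : ℝ} (hc : 0 ≤ c) {A : GramTuple g d} (hA : A ∈ putinarCone g d) :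
    c • A ∈ putinarCone g d := by
  obtain ⟨h1, h2, h3, h4⟩ := hA
  refine ⟨h1.smul hc, fun j => (h2 j).smul hc, fun j hj => ?_, ?_⟩
  · simp [h3 j hj]
  · rw [map_smul]
    exact Submodule.smul_mem _ _ h4

theorem zero_mem_putinarCone : (0 : GramTuple g d) ∈ putinarCone g d :=
  ⟨.zero, fun _ => .zero, fun _ _ => rfl, by simp⟩

theorem gramPolynomial_mul_nonneg {x : Fin n → ℝ} (hx : x ∈ basicSemialgebraicSet g) {k : ℕ}
    {A : Matrix (MultiIndex n k) (MultiIndex n k) ℝ} (hA : A.PosSemidef) (j : Fin m) :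
    0 ≤ eval x (gramPolynomial A * g j) := by
  rw [map_mul]
  exact mul_nonneg (eval_gramPolynomial_nonneg hA x) (hx j)

theorem IsPutinarFeasible.eval_nonneg {p : MvPolynomial (Fin n) ℝ} (hp : IsPutinarFeasible g d p)
    {x : Fin n → ℝ} (hx : x ∈ basicSemialgebraicSet g) : 0 ≤ eval x p := by
  obtain ⟨-, A₀, A, hA₀, hA, rfl⟩ := hp
  rw [map_add, map_sum]
  exact add_nonneg (eval_gramPolynomial_nonneg hA₀ x)
    (Finset.sum_nonneg fun j _ => gramPolynomial_mul_nonneg hx (hA j) j)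

/-- All multiplier blocks are zero. The factor 2 comes from the cap `d` on the degree of the
polynomial, not from the size of `A₀`. -/
theorem isPutinarFeasible_sq {q : MvPolynomial (Fin n) ℝ} (hq : 2 * q.totalDegree ≤ d) :
    IsPutinarFeasible g d (q ^ 2) := by
  obtain ⟨A, hA, hAq⟩ := exists_posSemidef_gramPolynomial_eq_sq (q := q) (d := d) (by omega)
  refine ⟨(totalDegree_pow _ _).trans hq, A, 0, hA, fun _ => .zero, ?_⟩
  rw [hAq, Finset.sum_eq_zero, add_zero]
  intro j _
  simp [gramPolynomial]

/-- A polynomial in the truncated quadratic module that vanishes on a nonempty open subset of the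
semialgebraic set has only trivial normalized Gram representations. -/
theorem eq_zero_of_putinarLinearMap_eq_zero {O : Set (Fin n → ℝ)} (hO : IsOpen O)
    (hne : O.Nonempty) (hOg : O ⊆ basicSemialgebraicSet g) {A : GramTuple g d}
    (hA : A ∈ putinarCone g d) (h : ∀ x ∈ O, eval x (putinarLinearMap g d A) = 0) : A = 0 := by
  obtain ⟨h0, hpos, hz, -⟩ := hA
  have hterms : ∀ x ∈ O, eval x (gramPolynomial A.1) = 0 ∧
      ∀ j, eval x (gramPolynomial (A.2 j) * g j) = 0 := by
    intro x hx
    have hj : ∀ j ∈ Finset.univ, 0 ≤ eval x (gramPolynomial (A.2 j) * g j) :=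
      fun j _ => gramPolynomial_mul_nonneg (hOg hx) (hpos j) j
    have h1 := h x hx
    rw [putinarLinearMap_apply, map_add, map_sum,
      add_eq_zero_iff_of_nonneg (eval_gramPolynomial_nonneg h0 x) (Finset.sum_nonneg hj),
      Finset.sum_eq_zero_iff_of_nonneg hj] at h1
    exact ⟨h1.1, fun j => h1.2 j (Finset.mem_univ j)⟩
  refine Prod.ext (eq_zero_of_gramPolynomial_eq_zero h0 <|
    eq_zero_of_eval_eq_zero_on_isOpen hO hne fun x hx => (hterms x hx).1) (funext fun j => ?_)
  have hj := eq_zero_of_eval_eq_zero_on_isOpen hO hne fun x hx => (hterms x hx).2 j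
  rcases mul_eq_zero.1 hj with hj | hj
  · exact eq_zero_of_gramPolynomial_eq_zero (hpos j) hj
  · exact hz j hj

variable {lam : Measure (Fin n → ℝ)} [IsFiniteMeasure lam]

theorem exists_isPutinarOptimal (hcompact : IsCompact (basicSemialgebraicSet g))
    (hlam : lam (basicSemialgebraicSet g)ᶜ = 0) {O : Set (Fin n → ℝ)} (hO : IsOpen O)
    (hne : O.Nonempty) (hOg : O ⊆ basicSemialgebraicSet g) (hsupp : O ⊆ lam.support)
    {u : (Fin n → ℝ) → ℝ} (hu : MemLp u 2 lam) : ∃ p, IsPutinarOptimal g lam u d p := by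
  have hL := memLp_eval hcompact hlam
  let ι : MvPolynomial (Fin n) ℝ →ₗ[ℝ] Lp ℝ 2 lam :=
    { toFun p := (hL p).toLp
      map_add' p q := by
        rw [← MemLp.toLp_add]
        exact MemLp.toLp_congr _ _ (.of_forall fun x => by simp)
      map_smul' c p := by
        rw [RingHom.id_apply, ← MemLp.toLp_const_smul]
        exact MemLp.toLp_congr _ _ (.of_forall fun x => by simp) }
  have hinner : ∀ p, inner ℝ (ι 1) (ι p) = ∫ x, eval x p ∂lam := by
    intro p
    rw [L2.inner_def]
    refine integral_congr_ae ?_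
    filter_upwards [(hL 1).coeFn_toLp, (hL p).coeFn_toLp] with x h1 hp
    change inner ℝ ((hL 1).toLp _ x) ((hL p).toLp _ x) = _
    rw [h1, hp]
    simp
  have hpos : ∀ A ∈ putinarCone g d, A ≠ 0 →
      0 < inner ℝ (ι 1) ((ι ∘ₗ putinarLinearMap g d) A) := by
    intro A hA hA0
    set p := putinarLinearMap g d A with hp
    have hp0 : 0 ≤ᵐ[lam] fun x => eval x p := by
      filter_upwards [mem_ae_iff.2 hlam] with x hx
      exact (isPutinarFeasible_iff.2 ⟨A, hA, rfl⟩).eval_nonneg hx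
    rw [LinearMap.comp_apply, hinner]
    refine (integral_nonneg_of_ae hp0).lt_of_ne' fun hzero => hA0 ?_
    rw [integral_eq_zero_iff_of_nonneg_ae hp0 ((hL p).integrable (by simp))] at hzero
    exact eq_zero_of_putinarLinearMap_eq_zero hO hne hOg hA fun x hx =>
      p.continuous_eval.eq_zero_of_mem_measure_support hzero (hsupp hx)
  obtain ⟨A, hA, hmin⟩ := exists_forall_norm_sub_le_of_closed_cone isClosed_putinarCone
    zero_mem_putinarCone (fun c hc x hx => smul_mem_putinarCone hc hx)
    (ι ∘ₗ putinarLinearMap g d) (ι 1) hpos (hu.toLp u)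
  refine ⟨_, isPutinarFeasible_iff.2 ⟨A, hA, rfl⟩, fun q hq => ?_⟩
  obtain ⟨B, hB, rfl⟩ := isPutinarFeasible_iff.1 hq
  rw [sqL2Dist_eq hlam hu (hL _), sqL2Dist_eq hlam hu (hL _)]
  exact pow_le_pow_left₀ (norm_nonneg _) (hmin B hB) 2

end Feasible

end

/-! ### Main theorem -/

theorem proposition4 {n m : ℕ} (g : Fin m → MvPolynomial (Fin n) ℝ)
    (hcompact : IsCompact (basicSemialgebraicSet g))
    (hinterior : (interior (basicSemialgebraicSet g)).Nonempty)
    (lam : Measure (Fin n → ℝ)) [IsFiniteMeasure lam]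
    (hlam : lam (basicSemialgebraicSet g)ᶜ = 0)
    -- the support of `lam` contains some nonempty open subset of the set
    (hsupp : ∃ O : Set (Fin n → ℝ), IsOpen O ∧ O.Nonempty ∧ O ⊆ basicSemialgebraicSet g ∧
      O ⊆ lam.support)
    (u : (Fin n → ℝ) → ℝ) (hu_nonneg : ∀ᵐ x ∂lam, 0 ≤ u x) (hu : MemLp u 2 lam) :
    -- for every `d ≥ maxⱼ dⱼ` there is an optimal solution,
    (∀ d : ℕ, (∀ j, halfDegree (g j) ≤ d) → ∃ p, IsPutinarOptimal g lam u d p) ∧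
    -- every optimal solution is nonnegative on the set,
    (∀ d : ℕ, (∀ j, halfDegree (g j) ≤ d) → ∀ p, IsPutinarOptimal g lam u d p →
      ∀ x ∈ basicSemialgebraicSet g, 0 ≤ eval x p) ∧
    -- and every sequence of optimal solutions converges to `u` in `L²`.
    (∀ ustar : ℕ → MvPolynomial (Fin n) ℝ,
      (∀ d : ℕ, (∀ j, halfDegree (g j) ≤ d) → IsPutinarOptimal g lam u d (ustar d)) →
      Tendsto (fun d => sqL2Dist (basicSemialgebraicSet g) lam u (ustar d)) atTop (𝓝 0)) := by
  obtain ⟨O, hO, hne, hOg, hOs⟩ := hsupp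
  refine ⟨fun d _ => exists_isPutinarOptimal hcompact hlam hO hne hOg hOs hu,
    fun d _ p hp x hx => hp.1.eval_nonneg hx, fun ustar hopt => ?_⟩
  refine Metric.tendsto_atTop.2 fun ε hε => ?_
  obtain ⟨q, hq⟩ := exists_sqL2Dist_sq_lt hcompact hlam hu_nonneg hu hε
  -- The first term makes `q ^ 2` feasible; the sum crudely bounds the maximum of the `halfDegree (g
  -- j)`.
  refine ⟨2 * q.totalDegree + ∑ j, halfDegree (g j), fun d hd => ?_⟩
  have hdj : ∀ j, halfDegree (g j) ≤ d := fun j =>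
    (Finset.single_le_sum (f := fun j => halfDegree (g j)) (fun _ _ => Nat.zero_le _)
      (Finset.mem_univ j)).trans (by omega)
  have hnonneg : 0 ≤ sqL2Dist (basicSemialgebraicSet g) lam u (ustar d) :=
    integral_nonneg fun x => sq_nonneg _
  rw [Real.dist_0_eq_abs, abs_of_nonneg hnonneg]
  exact ((hopt d hdj).2 _ (isPutinarFeasible_sq (by omega))).trans_lt hq
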